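/- An affine plane is a set of points with a family of subsets, called lines, such that any two distinct points lie on exactly one line; for each line $\ell$ and each point $P\notin\ell$ there is exactly one line through $P$ disjoint from $\ell$; and there are three distinct points not on a common line. Two lines are parallel if they are equal or disjoint. It is a Desargues affine plane if the following holds. Let $a,b,c$ be three distinct lines that are mutually parallel or have a common point, and let $A\ne A'$ on $a$, $B\neq B'$ on $b$, $C\neq C'$ on $c$, where $A,B,C$ are pairwise distinct and $A',B',C'$ are pairwise distinct. If $AB\parallel A'B'$ and $BC\parallel B'C'$, then $AC\parallel A'C'$. Let $O\neq I$ be points of a Desargues affine plane and let $\ell^{OI}$ be the line through them. For $A,B\in\ell^{OI}$ choose a point $B_1\notin\ell^{OI}$. The sum $A+B$ is the intersection of $\ell^{OI}$ with the parallel to $BB_1$ through $P_1$, where $P_1$ is the intersection of the parallel to $\ell^{OI}$ through $B_1$ and the parallel to $OB_1$ through $A$. The product $A\cdot B$ is the intersection of $\ell^{OI}$ with the parallel to $BB_1$ through $P_1$, where now $P_1$ is the intersection of the parallel to $IB_1$ through $A$ and the line $OB_1$. Write $-A$ for the point of $\ell^{OI}$ with $A+(-A)=O$, $A-B=A+(-B)$,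 and, for $A\ne O$, $A^{-1}$ for the point of $\ell^{OI}$ with $A\cdot A^{-1}=I$. For $A,B,C,D\in\ell^{OI}$, no three of them equal, the cross ratio is $$c_r(A,B;C,D)=\left[(A-D)^{-1}(B-D)\right]\left[(B-C)^{-1}(A-C)\right],$$ with the convention $O^{-1}=\infty$, so that $c_r(A,B;C,D)=\infty$ if $A=D$ or $B=C$. The reflection about $O$ is the map $A\mapsto(-I)\cdot A$. Then the reflection about $O$ maps $\ell^{OI}$ into itself, and $(-I)\cdot A=-A$ for all $A\in\ell^{OI}$. Moreover, if $A,B,C,D\in\ell^{OI}$ and no three of them are equal, then no three of $-A,-B,-C,-D$ are equal, and $$c_r(-A,-B;-C,-D)=c_r(A,B;C,D).$$ -/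

import Mathlib

/-- An affine plane on the point set `Pt`: a family of subsets of `Pt`, called lines, such that
two distinct points lie on exactly one line, Playfair's axiom holds, and there are three distinct
points that do not lie on a common line. -/
structure AffinePlane (Pt : Type*) where
  lines : Set (Set Pt)
  join : ∀ P Q : Pt, P ≠ Q → ∃! l : Set Pt, l ∈ lines ∧ P ∈ l ∧ Q ∈ l
  playfair : ∀ (P : Pt) (l : Set Pt), l ∈ lines → P ∉ l →
    ∃! m : Set Pt, m ∈ lines ∧ P ∈ m ∧ l ∩ m = ∅
  noncollinear : ∃ P Q R : Pt, P ≠ Q ∧ Q ≠ R ∧ P ≠ R ∧ ¬ ∃ l ∈ lines, P ∈ l ∧ Q ∈ l ∧ R ∈ l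

/-- Two lines of an affine plane are parallel if they are equal or disjoint. -/
def LinesParallel {Pt : Type*} (l m : Set Pt) : Prop := l = m ∨ l ∩ m = ∅

namespace AffinePlane

variable {Pt : Type*} (π : AffinePlane Pt)

/-- The line `ℓ^{PQ}` through two distinct points `P`, `Q`
(see `line_mem_lines` and `line_eq`). -/
def line (P Q : Pt) : Set Pt := {X | ∃ l ∈ π.lines, P ∈ l ∧ Q ∈ l ∧ X ∈ l}

/-- The line `ℓ_{PQ}^R` through `R` parallel to the line through two distinct points `P`, `Q`
(see `parallelThrough_mem_lines` and `eq_parallelThrough`). -/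
def parallelThrough (R P Q : Pt) : Set Pt :=
  {X | ∃ m ∈ π.lines, R ∈ m ∧ LinesParallel (π.line P Q) m ∧ X ∈ m}

theorem line_eq {P Q : Pt} (h : P ≠ Q) {l : Set Pt} (hl : l ∈ π.lines) (hP : P ∈ l)
    (hQ : Q ∈ l) : π.line P Q = l := by
  ext X
  constructor
  · rintro ⟨m, hm, hPm, hQm, hX⟩
    rwa [(π.join P Q h).unique ⟨hl, hP, hQ⟩ ⟨hm, hPm, hQm⟩]
  · intro hX
    exact ⟨l, hl, hP, hQ, hX⟩

theorem line_mem_lines {P Q : Pt} (h : P ≠ Q) : π.line P Q ∈ π.lines := by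
  obtain ⟨l, ⟨hl, hP, hQ⟩, -⟩ := π.join P Q h
  rwa [π.line_eq h hl hP hQ]

theorem existsUnique_parallel (R : Pt) {l : Set Pt} (hl : l ∈ π.lines) :
    ∃! m : Set Pt, m ∈ π.lines ∧ R ∈ m ∧ LinesParallel l m := by
  by_cases hR : R ∈ l
  · refine ⟨l, ⟨hl, hR, Or.inl rfl⟩, ?_⟩
    rintro m ⟨-, hRm, h | h⟩
    · exact h.symm
    · exact absurd (show R ∈ l ∩ m from ⟨hR, hRm⟩) (by simp [h])
  · obtain ⟨m, ⟨hm, hRm, hd⟩, hu⟩ := π.playfair R l hl hR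
    refine ⟨m, ⟨hm, hRm, Or.inr hd⟩, ?_⟩
    rintro m' ⟨hm', hRm', h | h⟩
    · exact absurd (h ▸ hRm') hR
    · exact hu m' ⟨hm', hRm', h⟩

theorem eq_parallelThrough {R P Q : Pt} (h : P ≠ Q) {m : Set Pt} (hm : m ∈ π.lines)
    (hR : R ∈ m) (hp : LinesParallel (π.line P Q) m) : π.parallelThrough R P Q = m := by
  ext X
  constructor
  · rintro ⟨m', hm', hR', hp', hX⟩
    rwa [(π.existsUnique_parallel R (π.line_mem_lines h)).unique ⟨hm, hR, hp⟩ ⟨hm', hR', hp'⟩]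
  · intro hX
    exact ⟨m, hm, hR, hp, hX⟩

theorem parallelThrough_mem_lines (R : Pt) {P Q : Pt} (h : P ≠ Q) :
    π.parallelThrough R P Q ∈ π.lines ∧ R ∈ π.parallelThrough R P Q ∧
      LinesParallel (π.line P Q) (π.parallelThrough R P Q) := by
  obtain ⟨m, ⟨hm, hR, hp⟩, -⟩ := π.existsUnique_parallel R (π.line_mem_lines h)
  rw [π.eq_parallelThrough h hm hR hp]
  exact ⟨hm, hR, hp⟩

/-- `C` is obtained from points `A`, `B` of the line `ℓ^{OI}` by the addition construction:
choose `B₁` off `ℓ^{OI}`, let `P₁` be the intersection of `ℓ_{OI}^{B₁}` and `ℓ_{OB₁}^{A}`,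
and let `C` be the intersection of `ℓ_{BB₁}^{P₁}` and `ℓ^{OI}`. -/
def IsSum (O I A B C : Pt) : Prop :=
  ∃ B₁ P₁ : Pt, B₁ ∉ π.line O I ∧
    P₁ ∈ π.parallelThrough B₁ O I ∩ π.parallelThrough A O B₁ ∧
    C ∈ π.parallelThrough P₁ B B₁ ∩ π.line O I

/-- `C` is obtained from points `A`, `B` of the line `ℓ^{OI}` by the multiplication construction:
choose `B₁` off `ℓ^{OI}`, let `P₁` be the intersection of `ℓ_{IB₁}^{A}` and `ℓ^{OB₁}`,
and let `C` be the intersection of `ℓ_{BB₁}^{P₁}` and `ℓ^{OI}`. -/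
def IsProd (O I A B C : Pt) : Prop :=
  ∃ B₁ P₁ : Pt, B₁ ∉ π.line O I ∧
    P₁ ∈ π.parallelThrough A I B₁ ∩ π.line O B₁ ∧
    C ∈ π.parallelThrough P₁ B B₁ ∩ π.line O I

/-- The sum `A + B` of points of the line `ℓ^{OI}`. -/
noncomputable def add (O I A B : Pt) : Pt :=
  @Classical.epsilon Pt ⟨O⟩ (fun C => π.IsSum O I A B C)

/-- The product `A · B` of points of the line `ℓ^{OI}`. -/
noncomputable def mul (O I A B : Pt) : Pt :=
  @Classical.epsilon Pt ⟨O⟩ (fun C => π.IsProd O I A B C)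

/-- The opposite point `-A` on `ℓ^{OI}`: the point `X` of the line with `A + X = O`. -/
noncomputable def neg (O I A : Pt) : Pt :=
  @Classical.epsilon Pt ⟨O⟩ (fun X => X ∈ π.line O I ∧ π.add O I A X = O)

/-- The inverse `A⁻¹` of a point `A ≠ O` of `ℓ^{OI}`: the point `X` of the line
with `A · X = I`. -/
noncomputable def inv (O I A : Pt) : Pt :=
  @Classical.epsilon Pt ⟨O⟩ (fun X => X ∈ π.line O I ∧ π.mul O I A X = I)

/-- The difference `A - B = A + (-B)` of points of the line `ℓ^{OI}`. -/
noncomputable def sub (O I A B : Pt) : Pt := π.add O I A (π.neg O I B)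

open Classical in
/-- The cross ratio `c_r(A,B;C,D) = [(A-D)⁻¹(B-D)] [(B-C)⁻¹(A-C)]` of four points of `ℓ^{OI}`,
no three of them equal, with the convention `O⁻¹ = ∞`: for such points the value is the point at
infinity exactly when `A = D` or `B = C`, and otherwise it is a point of the line. -/
noncomputable def crossRatio (O I A B C D : Pt) : OnePoint Pt :=
  if A = D ∨ B = C then OnePoint.infty
  else OnePoint.some
    (π.mul O I
      (π.mul O I (π.inv O I (π.sub O I A D)) (π.sub O I B D))
      (π.mul O I (π.inv O I (π.sub O I B C)) (π.sub O I A C)))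

/-- The inversion `j_P` of `ℓ^{OI}` with a point `P` of the line: `j_P(A) = P · A`. -/
noncomputable def inversion (O I P A : Pt) : Pt := π.mul O I P A

/-- The reflection of `ℓ^{OI}` about the point `O`: the inversion with `-I`, that is
`A ↦ (-I) · A`. -/
noncomputable def reflection (O I A : Pt) : Pt := π.inversion O I (π.neg O I I) A

end AffinePlane

/-- No three of the four points `A`, `B`, `C`, `D` are equal. -/
def NoThreeEqual {Pt : Type*} (A B C D : Pt) : Prop :=
  ¬ (A = B ∧ B = C) ∧ ¬ (A = B ∧ B = D) ∧ ¬ (A = C ∧ C = D) ∧ ¬ (B = C ∧ C = D)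

/-- A Desargues affine plane: an affine plane in which Desargues' axiom holds. Here `a`, `b`, `c`
are three distinct lines, all parallel or all through a common point, that carry the pairs of
distinct points `A, A'`, `B, B'`, `C, C'`. -/
structure DesarguesAffinePlane (Pt : Type*) extends AffinePlane Pt where
  desargues : ∀ a ∈ lines, ∀ b ∈ lines, ∀ c ∈ lines, a ≠ b → b ≠ c → a ≠ c →
    (LinesParallel a b ∧ LinesParallel b c ∧ LinesParallel a c ∨
      ∃ P : Pt, P ∈ a ∧ P ∈ b ∧ P ∈ c) →
    ∀ A ∈ a, ∀ A' ∈ a, ∀ B ∈ b, ∀ B' ∈ b, ∀ C ∈ c, ∀ C' ∈ c,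
    A ≠ A' → B ≠ B' → C ≠ C' →
    A ≠ B → A' ≠ B' → B ≠ C → B' ≠ C' → A ≠ C → A' ≠ C' →
    LinesParallel (toAffinePlane.line A B) (toAffinePlane.line A' B') →
    LinesParallel (toAffinePlane.line B C) (toAffinePlane.line B' C') →
    LinesParallel (toAffinePlane.line A C) (toAffinePlane.line A' C')

/-! The algebra on `ℓ^{OI}` comes from dilations, the maps of the plane that send every line into a
parallel line. Desargues' axiom extends P ↦ P' along a parallel or central pencil to a bijective
dilation (`exists_perm`). This yields a translation τ_A with τ_A(O) = A and, for A ≠ O, a dilation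
δ_A that fixes O and sends I to A; δ_O is the constant map O. The figures defining sum and product
are images under these maps, so A + B = τ_A(B) and A · B = δ_A(B), whatever the auxiliary point
(`isSum_iff`, `isProd_iff`).

Put σ(X) = τ_X⁻¹(O). Then τ_A(X) = O exactly when X = σ(A), so -A = σ(A). As translations commute, σ
is itself a dilation fixing O (`isDilationMap_pointReflection`); it sends I to -I, hence (-I) · A =
σ(A) = -A.

A bijective dilation δ fixing O conjugates τ_X to τ_{δ(X)}, so it commutes with σ
(`map_pointReflection`). It follows that σ is additive, that σ(A) · B = A · σ(B) = σ(A · B), and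
that σ commutes with inverses. In each bracket of the cross ratio both factors change sign and the
signs cancel; since σ is injective, coincidences of points, and with them the value ∞, are
preserved. -/

namespace LinesParallel

variable {Pt : Type*} {l m : Set Pt}

theorem refl (l : Set Pt) : LinesParallel l l := Or.inl rfl

theorem symm (h : LinesParallel l m) : LinesParallel m l :=
  h.imp Eq.symm fun h => by rwa [Set.inter_comm]

theorem eq_of_mem (h : LinesParallel l m) {X : Pt} (hl : X ∈ l) (hm : X ∈ m) : l = m := by
  rcases h with h | h
  · exact h
  · exact absurd (show X ∈ l ∩ m from ⟨hl, hm⟩) (by simp [h])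

end LinesParallel

theorem exists_mem_of_not_linesParallel {Pt : Type*} {l m : Set Pt} (h : ¬ LinesParallel l m) :
    ∃ X, X ∈ l ∧ X ∈ m :=
  Set.nonempty_iff_ne_empty.2 fun h' => h (Or.inr h')

theorem not_linesParallel_of_mem {Pt : Type*} {l m : Set Pt} {X : Pt} (hne : l ≠ m)
    (hl : X ∈ l) (hm : X ∈ m) : ¬ LinesParallel l m :=
  fun h => hne (h.eq_of_mem hl hm)

/-! ### Incidence and parallels in an affine plane -/

namespace AffinePlane

variable {Pt : Type*} (π : AffinePlane Pt)

theorem left_mem_line {P Q : Pt} (h : P ≠ Q) : P ∈ π.line P Q := by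
  obtain ⟨l, ⟨hl, hP, hQ⟩, -⟩ := π.join P Q h
  rwa [π.line_eq h hl hP hQ]

theorem right_mem_line {P Q : Pt} (h : P ≠ Q) : Q ∈ π.line P Q := by
  obtain ⟨l, ⟨hl, hP, hQ⟩, -⟩ := π.join P Q h
  rwa [π.line_eq h hl hP hQ]

theorem lines_eq {l m : Set Pt} (hl : l ∈ π.lines) (hm : m ∈ π.lines) {P Q : Pt} (h : P ≠ Q)
    (hPl : P ∈ l) (hQl : Q ∈ l) (hPm : P ∈ m) (hQm : Q ∈ m) : l = m :=
  (π.join P Q h).unique ⟨hl, hPl, hQl⟩ ⟨hm, hPm, hQm⟩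

theorem points_eq {l m : Set Pt} (hl : l ∈ π.lines) (hm : m ∈ π.lines) (hne : l ≠ m) {P Q : Pt}
    (hPl : P ∈ l) (hPm : P ∈ m) (hQl : Q ∈ l) (hQm : Q ∈ m) : P = Q :=
  by_contra fun h => hne (π.lines_eq hl hm h hPl hQl hPm hQm)

theorem linesParallel_trans {l m n : Set Pt} (hl : l ∈ π.lines) (hm : m ∈ π.lines)
    (hn : n ∈ π.lines) (hlm : LinesParallel l m) (hmn : LinesParallel m n) :
    LinesParallel l n := by
  by_contra h
  obtain ⟨X, hXl, hXn⟩ := exists_mem_of_not_linesParallel h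
  exact h (Or.inl ((π.existsUnique_parallel X hm).unique ⟨hl, hXl, hlm.symm⟩ ⟨hn, hXn, hmn⟩))

theorem exists_notMem {l : Set Pt} (hl : l ∈ π.lines) : ∃ X, X ∉ l := by
  obtain ⟨P, Q, R, -, -, -, h⟩ := π.noncollinear
  by_contra! h'
  exact h ⟨l, hl, h' P, h' Q, h' R⟩

theorem exists_ne (π : AffinePlane Pt) (P : Pt) : ∃ Q, P ≠ Q := by
  obtain ⟨X, Y, R, h, -⟩ := π.noncollinear
  by_cases hX : P = X
  · exact ⟨Y, hX ▸ h⟩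
  · exact ⟨X, hX⟩

theorem exists_line (P Q : Pt) : ∃ l ∈ π.lines, P ∈ l ∧ Q ∈ l := by
  by_cases h : P = Q
  · obtain ⟨R, hR⟩ := π.exists_ne P
    exact ⟨_, π.line_mem_lines hR, π.left_mem_line hR, h ▸ π.left_mem_line hR⟩
  · exact ⟨_, π.line_mem_lines h, π.left_mem_line h, π.right_mem_line h⟩

/-- The line through the point `P` parallel to the line `l`. -/
def par (P : Pt) (l : Set Pt) : Set Pt :=
  {X | ∃ m ∈ π.lines, P ∈ m ∧ LinesParallel l m ∧ X ∈ m}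

theorem par_eq {P : Pt} {l m : Set Pt} (hl : l ∈ π.lines) (hm : m ∈ π.lines) (hP : P ∈ m)
    (h : LinesParallel l m) : π.par P l = m := by
  ext X
  constructor
  · rintro ⟨m', hm', hP', h', hX⟩
    rwa [(π.existsUnique_parallel P hl).unique ⟨hm, hP, h⟩ ⟨hm', hP', h'⟩]
  · exact fun hX => ⟨m, hm, hP, h, hX⟩

theorem par_spec (P : Pt) {l : Set Pt} (hl : l ∈ π.lines) :
    π.par P l ∈ π.lines ∧ P ∈ π.par P l ∧ LinesParallel l (π.par P l) := by
  obtain ⟨m, ⟨hm, hP, h⟩, -⟩ := π.existsUnique_parallel P hl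
  rw [π.par_eq hl hm hP h]
  exact ⟨hm, hP, h⟩

theorem par_mem_lines (P : Pt) {l : Set Pt} (hl : l ∈ π.lines) : π.par P l ∈ π.lines :=
  (π.par_spec P hl).1

theorem mem_par (P : Pt) {l : Set Pt} (hl : l ∈ π.lines) : P ∈ π.par P l :=
  (π.par_spec P hl).2.1

theorem linesParallel_par (P : Pt) {l : Set Pt} (hl : l ∈ π.lines) :
    LinesParallel l (π.par P l) :=
  (π.par_spec P hl).2.2

theorem par_self {P : Pt} {l : Set Pt} (hl : l ∈ π.lines) (hP : P ∈ l) : π.par P l = l :=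
  π.par_eq hl hl hP (.refl l)

theorem par_congr {P : Pt} {l m : Set Pt} (hl : l ∈ π.lines) (hm : m ∈ π.lines)
    (h : LinesParallel l m) : π.par P l = π.par P m :=
  π.par_eq hl (π.par_mem_lines P hm) (π.mem_par P hm)
    (π.linesParallel_trans hl hm (π.par_mem_lines P hm) h (π.linesParallel_par P hm))

theorem par_eq_par {P Q : Pt} {l : Set Pt} (hl : l ∈ π.lines) (h : Q ∈ π.par P l) :
    π.par Q l = π.par P l :=
  π.par_eq hl (π.par_mem_lines P hl) h (π.linesParallel_par P hl)

theorem not_linesParallel_par {P Q : Pt} {l m : Set Pt} (hl : l ∈ π.lines) (hm : m ∈ π.lines)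
    (h : ¬ LinesParallel l m) : ¬ LinesParallel (π.par P l) (π.par Q m) := fun h' =>
  h (π.linesParallel_trans hl (π.par_mem_lines P hl) hm (π.linesParallel_par P hl)
    (π.linesParallel_trans (π.par_mem_lines P hl) (π.par_mem_lines Q hm) hm h'
      (π.linesParallel_par Q hm).symm))

theorem eq_of_mem_par {P Q X Y : Pt} {l m : Set Pt} (hl : l ∈ π.lines) (hm : m ∈ π.lines)
    (h : ¬ LinesParallel l m) (hX : X ∈ π.par P l) (hX' : X ∈ π.par Q m)
    (hY : Y ∈ π.par P l) (hY' : Y ∈ π.par Q m) : X = Y :=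
  π.points_eq (π.par_mem_lines P hl) (π.par_mem_lines Q hm)
    (fun h' => π.not_linesParallel_par hl hm h (Or.inl h')) hX hX' hY hY'

theorem not_linesParallel_line {A B C : Pt} (hAB : A ≠ B) (hC : C ∉ π.line A B) :
    ¬ LinesParallel (π.line A C) (π.line B C) := by
  have hAC : A ≠ C := fun h => hC (h ▸ π.left_mem_line hAB)
  have hBC : B ≠ C := fun h => hC (h ▸ π.right_mem_line hAB)
  refine not_linesParallel_of_mem (fun h => hC ?_) (π.right_mem_line hAC) (π.right_mem_line hBC)
  rw [π.line_eq hAB (π.line_mem_lines hAC) (π.left_mem_line hAC) (h ▸ π.left_mem_line hBC)]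
  exact π.right_mem_line hAC

/-! ### Dilation maps -/

/-- There are parallel lines, one through `A` and `B` and the other through `C` and `D`. For
`A ≠ B` and `C ≠ D` the lines `AB` and `CD` are parallel, otherwise this is no condition. -/
def Para (A B C D : Pt) : Prop :=
  ∃ l ∈ π.lines, ∃ m ∈ π.lines, A ∈ l ∧ B ∈ l ∧ C ∈ m ∧ D ∈ m ∧ LinesParallel l m

namespace Para

variable {π} {A B C D E F : Pt}

theorem symm (h : π.Para A B C D) : π.Para C D A B := by
  obtain ⟨l, hl, m, hm, hA, hB, hC, hD, h⟩ := h
  exact ⟨m, hm, l, hl, hC, hD, hA, hB, h.symm⟩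

theorem swap (h : π.Para A B C D) : π.Para B A D C := by
  obtain ⟨l, hl, m, hm, hA, hB, hC, hD, h⟩ := h
  exact ⟨l, hl, m, hm, hB, hA, hD, hC, h⟩

theorem of_mem {l : Set Pt} (hl : l ∈ π.lines) (hA : A ∈ l) (hB : B ∈ l) (hD : D ∈ π.par C l) :
    π.Para A B C D :=
  ⟨l, hl, _, π.par_mem_lines C hl, hA, hB, π.mem_par C hl, hD, π.linesParallel_par C hl⟩

theorem of_mem_mem {l : Set Pt} (hl : l ∈ π.lines) (hA : A ∈ l) (hB : B ∈ l) (hC : C ∈ l)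
    (hD : D ∈ l) : π.Para A B C D :=
  ⟨l, hl, l, hl, hA, hB, hC, hD, .refl l⟩

theorem of_right_eq (A B C : Pt) : π.Para A B C C := by
  obtain ⟨l, hl, hA, hB⟩ := π.exists_line A B
  exact of_mem hl hA hB (π.mem_par C hl)

theorem of_left_eq (A C D : Pt) : π.Para A A C D := (of_right_eq C D A).symm

theorem mem_par (h : π.Para A B C D) (hAB : A ≠ B) {l : Set Pt} (hl : l ∈ π.lines)
    (hA : A ∈ l) (hB : B ∈ l) : D ∈ π.par C l := by
  obtain ⟨l', hl', m, hm, hA', hB', hC, hD, h⟩ := h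
  obtain rfl := π.lines_eq hl hl' hAB hA hB hA' hB'
  rwa [π.par_eq hl hm hC h]

theorem mem_par_line (h : π.Para A B C D) (hAB : A ≠ B) : D ∈ π.par C (π.line A B) :=
  h.mem_par hAB (π.line_mem_lines hAB) (π.left_mem_line hAB) (π.right_mem_line hAB)

theorem linesParallel (h : π.Para A B C D) (hAB : A ≠ B) (hCD : C ≠ D) :
    LinesParallel (π.line A B) (π.line C D) := by
  obtain ⟨l, hl, m, hm, hA, hB, hC, hD, h⟩ := h
  rwa [π.line_eq hAB hl hA hB, π.line_eq hCD hm hC hD]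

end Para

/-- The maps for which the image of every line lies on a parallel line: dilations and constant
maps. -/
def IsDilationMap (f : Pt → Pt) : Prop := ∀ X Y, π.Para X Y (f X) (f Y)

namespace IsDilationMap

variable {π} {f g : Pt → Pt}

theorem mem_par (hf : π.IsDilationMap f) {X Y : Pt} {l : Set Pt} (hl : l ∈ π.lines)
    (hX : X ∈ l) (hY : Y ∈ l) : f Y ∈ π.par (f X) l := by
  by_cases h : X = Y
  · subst h
    exact π.mem_par _ hl
  · exact (hf X Y).mem_par h hl hX hY

theorem map_mem_par (hf : π.IsDilationMap f) {X Y : Pt} {l : Set Pt} (hl : l ∈ π.lines)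
    (hY : Y ∈ π.par X l) : f Y ∈ π.par (f X) l := by
  rw [π.par_congr hl (π.par_mem_lines X hl) (π.linesParallel_par X hl)]
  exact hf.mem_par (π.par_mem_lines X hl) (π.mem_par X hl) hY

theorem const (P : Pt) : π.IsDilationMap fun _ => P := fun X Y => .of_right_eq X Y P

theorem id : π.IsDilationMap _root_.id := fun X Y => by
  obtain ⟨l, hl, hX, hY⟩ := π.exists_line X Y
  exact .of_mem_mem hl hX hY hX hY

theorem comp (hg : π.IsDilationMap g) (hf : π.IsDilationMap f) : π.IsDilationMap (g ∘ f) := by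
  intro X Y
  obtain ⟨l, hl, hX, hY⟩ := π.exists_line X Y
  exact .of_mem hl hX hY (hg.map_mem_par hl (hf.mem_par hl hX hY))

/-- The image of Z lies on the parallels to XZ and YZ through two known points, and these parallels
meet only once. -/
theorem eq_of_notMem (hf : π.IsDilationMap f) (hg : π.IsDilationMap g) {X Y Z : Pt} (hne : X ≠ Y)
    (hX : f X = g X) (hY : f Y = g Y) (hZ : Z ∉ π.line X Y) : f Z = g Z := by
  have hXZ : X ≠ Z := fun h => hZ (h ▸ π.left_mem_line hne)
  have hYZ : Y ≠ Z := fun h => hZ (h ▸ π.right_mem_line hne)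
  refine π.eq_of_mem_par (π.line_mem_lines hXZ) (π.line_mem_lines hYZ)
    (π.not_linesParallel_line hne hZ) ((hf X Z).mem_par_line hXZ) ((hf Y Z).mem_par_line hYZ) ?_ ?_
  · rw [hX]
    exact (hg X Z).mem_par_line hXZ
  · rw [hY]
    exact (hg Y Z).mem_par_line hYZ

theorem ext (hf : π.IsDilationMap f) (hg : π.IsDilationMap g) {X Y : Pt} (hne : X ≠ Y)
    (hX : f X = g X) (hY : f Y = g Y) : f = g := by
  funext Z
  by_cases hZ : Z ∈ π.line X Y
  -- For Z on XY, a point W off XY replaces Y: then Z is off XW.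
  · obtain ⟨W, hW⟩ := π.exists_notMem (π.line_mem_lines hne)
    have hXW : X ≠ W := fun h => hW (h ▸ π.left_mem_line hne)
    by_cases hZX : X = Z
    · rw [← hZX, hX]
    refine hf.eq_of_notMem hg hXW hX (hf.eq_of_notMem hg hne hX hY hW) fun h => hW ?_
    rw [π.lines_eq (π.line_mem_lines hne) (π.line_mem_lines hXW) hZX (π.left_mem_line hne) hZ
      (π.left_mem_line hXW) h]
    exact π.right_mem_line hXW
  · exact hf.eq_of_notMem hg hne hX hY hZ

end IsDilationMap

/-- If two lines cover the plane, there are no three points of the one off the other. -/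
theorem not_three_points_of_cover {p b : Set Pt} (hp : p ∈ π.lines) (hb : b ∈ π.lines)
    (hcover : ∀ Z, Z ∈ p ∨ Z ∈ b) {X Y Z B : Pt} (hX : X ∈ p) (hY : Y ∈ p) (hZ : Z ∈ p)
    (hX' : X ∉ b) (hY' : Y ∉ b) (hZ' : Z ∉ b) (hB : B ∈ b) (hB' : B ∉ p)
    (hXY : X ≠ Y) (hXZ : X ≠ Z) (hYZ : Y ≠ Z) : False := by
  have hXB : X ≠ B := fun h => hX' (h ▸ hB)
  have hYB : Y ≠ B := fun h => hY' (h ▸ hB)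
  have hl := π.line_mem_lines hXB
  have hlX := π.left_mem_line hXB
  have hlB := π.right_mem_line hXB
  have hlp : ¬ LinesParallel (π.line X B) p :=
    not_linesParallel_of_mem (fun h => hB' (h ▸ hlB)) hlX hX
  have hlb : ¬ LinesParallel (π.line X B) b :=
    not_linesParallel_of_mem (fun h => hX' (h ▸ hlX)) hlB hB
  -- V is where the parallel to XB through W cuts b.
  have key : ∀ W ∈ p, W ∉ b → X ≠ W → ∃ V ∈ b, V ≠ B ∧ V ∉ p ∧ V ∈ π.par W (π.line X B) := by
    intro W hW hWb hXW
    have h1 := π.par_mem_lines W hl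
    have h2 := π.mem_par W hl
    have h3 := π.linesParallel_par W hl
    have hnp : π.par W (π.line X B) ≠ p := fun h => hlp (h ▸ h3)
    obtain ⟨V, hV, hVb⟩ := exists_mem_of_not_linesParallel
      (fun h => hlb (π.linesParallel_trans hl h1 hb h3 h))
    refine ⟨V, hVb, ?_, fun hVp => ?_, hV⟩
    · rintro rfl
      rw [← h3.eq_of_mem hlB hV] at h2
      exact hXW (π.points_eq hl hp (fun h => hB' (h ▸ hlB)) hlX hX h2 hW)
    · exact hWb (π.points_eq h1 hp hnp h2 hW hV hVp ▸ hVb)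
  -- By the covering, XV and YB could meet only on p, forcing X = Y, or on b, forcing V = B.
  have dis : ∀ V ∈ b, V ≠ B → V ∉ p → ∃ n ∈ π.lines, X ∈ n ∧ V ∈ n ∧
      LinesParallel (π.line Y B) n := by
    intro V hVb hVB hVp
    have hXV : X ≠ V := fun h => hVp (h ▸ hX)
    refine ⟨_, π.line_mem_lines hXV, π.left_mem_line hXV, π.right_mem_line hXV, ?_⟩
    by_contra hn
    obtain ⟨W, hW, hW'⟩ := exists_mem_of_not_linesParallel hn
    rcases hcover W with h | h
    · have h1 : W = X := π.points_eq (π.line_mem_lines hXV) hp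
        (fun h => hVp (h ▸ π.right_mem_line hXV)) hW' h (π.left_mem_line hXV) hX
      have h2 : W = Y := π.points_eq (π.line_mem_lines hYB) hp
        (fun h => hB' (h ▸ π.right_mem_line hYB)) hW h (π.left_mem_line hYB) hY
      exact hXY (h1 ▸ h2)
    · have h1 : W = V := π.points_eq (π.line_mem_lines hXV) hb
        (fun h => hX' (h ▸ π.left_mem_line hXV)) hW' h (π.right_mem_line hXV) hVb
      have h2 : W = B := π.points_eq (π.line_mem_lines hYB) hb
        (fun h => hY' (h ▸ π.left_mem_line hYB)) hW h (π.right_mem_line hYB) hB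
      exact hVB (h1 ▸ h2)
  obtain ⟨V, hVb, hVB, hVp, hV⟩ := key Y hY hY' hXY
  obtain ⟨W, hWb, hWB, hWp, hW⟩ := key Z hZ hZ' hXZ
  obtain ⟨n, hn, hXn, hVn, hpn⟩ := dis V hVb hVB hVp
  obtain ⟨k, hk, hXk, hWk, hpk⟩ := dis W hWb hWB hWp
  -- XV and XW are both the parallel to YB through X, so this line shares V and W with b.
  obtain rfl := (π.existsUnique_parallel X (π.line_mem_lines hYB)).unique ⟨hn, hXn, hpn⟩
    ⟨hk, hXk, hpk⟩
  have hVW : V ≠ W := by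
    rintro rfl
    have h1 : π.par Y (π.line X B) = π.par Z (π.line X B) :=
      (π.par_eq_par hl hV).symm.trans (π.par_eq_par hl hW)
    have h2 : π.par Y (π.line X B) = p := π.lines_eq (π.par_mem_lines Y hl) hp hYZ
      (π.mem_par Y hl) (h1 ▸ π.mem_par Z hl) hY hZ
    exact hVp (h2 ▸ hV)
  exact hX' (π.lines_eq hn hb hVW hVn hWk hVb hWb ▸ hXn)

end AffinePlane

/-! ### Pencils of lines -/

namespace AffinePlane

variable {Pt : Type*} (π : AffinePlane Pt)

/-- A pencil of lines: its lines are all parallel, or they all pass through a common point. The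
points of `carrier` lie on exactly one line of the pencil. -/
structure Pencil where
  carrier : Set Pt
  ray : Pt → Set Pt
  ray_mem_lines : ∀ X ∈ carrier, ray X ∈ π.lines
  mem_ray : ∀ X ∈ carrier, X ∈ ray X
  ray_eq : ∀ X ∈ carrier, ∀ Y ∈ carrier, Y ∈ ray X → ray Y = ray X
  center_mem : ∀ X ∈ carrier, ∀ Z ∉ carrier, Z ∈ ray X
  center_unique : ∀ Z ∉ carrier, ∀ W ∉ carrier, Z = W
  -- The configuration of three lines that Desargues' axiom asks for.
  desargues : ∀ X ∈ carrier, ∀ Y ∈ carrier, ∀ Z ∈ carrier,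
    LinesParallel (ray X) (ray Y) ∧ LinesParallel (ray Y) (ray Z) ∧
      LinesParallel (ray X) (ray Z) ∨ ∃ P, P ∈ ray X ∧ P ∈ ray Y ∧ P ∈ ray Z

/-- The pencil of the lines parallel to `l`. -/
def parallelPencil {l : Set Pt} (hl : l ∈ π.lines) : π.Pencil where
  carrier := Set.univ
  ray X := π.par X l
  ray_mem_lines X _ := π.par_mem_lines X hl
  mem_ray X _ := π.mem_par X hl
  ray_eq _ _ _ _ h := π.par_eq_par hl h
  center_mem _ _ _ h := absurd trivial h
  center_unique _ h := absurd trivial h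
  desargues := by
    have h (X Y : Pt) : LinesParallel (π.par X l) (π.par Y l) :=
      π.linesParallel_trans (π.par_mem_lines X hl) hl (π.par_mem_lines Y hl)
        (π.linesParallel_par X hl).symm (π.linesParallel_par Y hl)
    exact fun X _ Y _ Z _ => Or.inl ⟨h X Y, h Y Z, h X Z⟩

/-- The pencil of the lines through `O`. -/
def centralPencil (O : Pt) : π.Pencil where
  carrier := {X | O ≠ X}
  ray X := π.line O X
  ray_mem_lines _ h := π.line_mem_lines h
  mem_ray _ h := π.right_mem_line h
  ray_eq _ hX _ hY h := π.line_eq hY (π.line_mem_lines hX) (π.left_mem_line hX) h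
  center_mem X hX Z hZ := by
    obtain rfl : O = Z := not_not.1 hZ
    exact π.left_mem_line hX
  center_unique Z hZ W hW := (not_not.1 hZ).symm.trans (not_not.1 hW)
  desargues _ hX _ hY _ hZ :=
    Or.inr ⟨O, π.left_mem_line hX, π.left_mem_line hY, π.left_mem_line hZ⟩

namespace Pencil

variable {π} (p : π.Pencil) {P P' X X' X'' Y Y' : Pt}

theorem mem_carrier (hP : P ∈ p.carrier) (hX : X ∉ p.ray P) : X ∈ p.carrier :=
  by_contra fun h => hX (p.center_mem P hP X h)

theorem notMem_ray_symm (hP : P ∈ p.carrier) (hX : X ∈ p.carrier) (h : X ∉ p.ray P) :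
    P ∉ p.ray X :=
  fun h' => h (p.ray_eq X hX P hP h' ▸ p.mem_ray X hX)

theorem ne_of_notMem_ray (hP : P ∈ p.carrier) (h : X ∉ p.ray P) : P ≠ X :=
  fun h' => h (h' ▸ p.mem_ray P hP)

theorem not_linesParallel_ray (hP : P ∈ p.carrier) (hX : X ∈ p.carrier) (h : X ∉ p.ray P) :
    ¬ LinesParallel (π.line P X) (p.ray X) :=
  have hne := p.ne_of_notMem_ray hP h
  not_linesParallel_of_mem (fun h' => p.notMem_ray_symm hP hX h (h' ▸ π.left_mem_line hne))
    (π.right_mem_line hne) (p.mem_ray X hX)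

/-- PX is not parallel to the ray of X, so its parallel through P' cuts that ray. The inequality X ≠
X' is needed for Desargues' axiom. -/
theorem exists_para (hP : P ∈ p.carrier) (hP' : P' ∈ p.carrier) (hPP' : P' ∈ p.ray P)
    (hne : P ≠ P') (hX : X ∉ p.ray P) :
    ∃ X' ∈ p.carrier, X' ∈ p.ray X ∧ X ≠ X' ∧ π.Para P X P' X' := by
  have hXc := p.mem_carrier hP hX
  have hPX := p.ne_of_notMem_ray hP hX
  have hl := π.line_mem_lines hPX
  have hr := p.ray_mem_lines P hP
  have hnp := p.not_linesParallel_ray hP hXc hX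
  have hlr : π.line P X ≠ p.ray P := fun h => hX (h ▸ π.right_mem_line hPX)
  obtain ⟨X', h1, h2⟩ := exists_mem_of_not_linesParallel (l := π.par P' (π.line P X))
    (m := p.ray X) fun h => hnp (π.linesParallel_trans hl (π.par_mem_lines P' hl)
      (p.ray_mem_lines X hXc) (π.linesParallel_par P' hl) h)
  have hne' : π.par P' (π.line P X) ≠ p.ray P := fun h =>
    not_linesParallel_of_mem hlr (π.left_mem_line hPX) (p.mem_ray P hP)
      (h ▸ π.linesParallel_par P' hl)
  have hX' : X' ∉ p.ray P := fun h => by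
    obtain rfl := π.points_eq (π.par_mem_lines P' hl) hr hne' h1 h (π.mem_par P' hl) hPP'
    exact hX (p.ray_eq P hP X' hP' h ▸ (p.ray_eq X hXc X' hP' h2).symm ▸ p.mem_ray X hXc)
  refine ⟨X', p.mem_carrier hP hX', h2, ?_, .of_mem hl (π.left_mem_line hPX)
    (π.right_mem_line hPX) h1⟩
  rintro rfl
  have h3 := (π.linesParallel_par P' hl).eq_of_mem (π.right_mem_line hPX) h1
  exact hlr (π.lines_eq hl hr hne (π.left_mem_line hPX) (h3 ▸ π.mem_par P' hl) (p.mem_ray P hP)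
    hPP')

theorem para_unique (hP : P ∈ p.carrier) (hX : X ∉ p.ray P) (h1 : X' ∈ p.ray X)
    (h2 : X'' ∈ p.ray X) (h3 : π.Para P X P' X') (h4 : π.Para P X P' X'') : X' = X'' := by
  have hXc := p.mem_carrier hP hX
  have hPX := p.ne_of_notMem_ray hP hX
  have hr := p.ray_mem_lines X hXc
  have hXr := p.mem_ray X hXc
  refine π.eq_of_mem_par (π.line_mem_lines hPX) hr (p.not_linesParallel_ray hP hXc hX)
    (h3.mem_par_line hPX) (Q := X) ?_ (h4.mem_par_line hPX) ?_ <;> rwa [π.par_self hr hXr]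

end Pencil

end AffinePlane

/-! ### Extending a trace to a dilation of the plane -/

namespace DesarguesAffinePlane

open AffinePlane

variable {Pt : Type*} (π : DesarguesAffinePlane Pt)

/-- `X` and `X'` are distinct points of the same line of the pencil. -/
structure IsTrace (p : π.Pencil) (X X' : Pt) : Prop where
  left_mem : X ∈ p.carrier
  right_mem : X' ∈ p.carrier
  mem_ray : X' ∈ p.ray X
  ne : X ≠ X'

variable {π} {p : π.Pencil} {P P' X X' Y Y' : Pt}

theorem IsTrace.ray_eq (hX : π.IsTrace p X X') : p.ray X' = p.ray X :=
  p.ray_eq X hX.left_mem X' hX.right_mem hX.mem_ray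

theorem IsTrace.ne_of_notMem_ray (hX : π.IsTrace p X X') (hY : π.IsTrace p Y Y')
    (h : Y ∉ p.ray X) : X ≠ Y ∧ X' ≠ Y' := by
  refine ⟨p.ne_of_notMem_ray hX.left_mem h, ?_⟩
  rintro rfl
  exact h (hX.ray_eq ▸ hY.ray_eq ▸ p.mem_ray Y hY.left_mem)

/-- Desargues' axiom with P, P' as the middle pair. If X and Y share a ray, the axiom does not
apply, but all four points lie on that ray. -/
theorem IsTrace.para (hP : π.IsTrace p P P') (hX : π.IsTrace p X X') (hY : π.IsTrace p Y Y')
    (hXP : X ∉ p.ray P) (hYP : Y ∉ p.ray P) (h1 : π.Para P X P' X') (h2 : π.Para P Y P' Y') :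
    π.Para X Y X' Y' := by
  have hXl := p.ray_mem_lines X hX.left_mem
  have hXr := p.mem_ray X hX.left_mem
  by_cases h : Y ∈ p.ray X
  · refine .of_mem_mem hXl hXr h hX.mem_ray ?_
    rw [← p.ray_eq X hX.left_mem Y hY.left_mem h]
    exact hY.mem_ray
  have hPX := hP.ne_of_notMem_ray hX hXP
  have hPY := hP.ne_of_notMem_ray hY hYP
  have hXY := hX.ne_of_notMem_ray hY h
  have hPr := p.mem_ray P hP.left_mem
  have hYr := p.mem_ray Y hY.left_mem
  have key := π.desargues _ hXl _ (p.ray_mem_lines P hP.left_mem) _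
    (p.ray_mem_lines Y hY.left_mem) (fun h => hXP (h ▸ hXr)) (fun h => hYP (h ▸ hYr))
    (fun h' => h (h' ▸ hYr)) (p.desargues X hX.left_mem P hP.left_mem Y hY.left_mem)
    X hXr X' hX.mem_ray P hPr P' hP.mem_ray Y hYr Y' hY.mem_ray hX.ne hP.ne hY.ne
    hPX.1.symm hPX.2.symm hPY.1 hPY.2 hXY.1 hXY.2
    (h1.swap.linesParallel hPX.1.symm hPX.2.symm) (h2.linesParallel hPY.1 hPY.2)
  exact ⟨_, π.line_mem_lines hXY.1, _, π.line_mem_lines hXY.2, π.left_mem_line hXY.1,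
    π.right_mem_line hXY.1, π.left_mem_line hXY.2, π.right_mem_line hXY.2, key⟩

/-- If two lines of a pencil cover the plane, then `X`, `X'` are the only points of their line of
the pencil. -/
theorem IsTrace.eq_or_eq_of_cover {B C : Pt} (hX : π.IsTrace p X X') (hB : B ∈ p.carrier)
    (hBX : B ∉ p.ray X) (hcover : ∀ Z, Z ∈ p.ray X ∨ Z ∈ p.ray B) (hC : C ∈ p.carrier)
    (hCX : C ∈ p.ray X) : C = X ∨ C = X' := by
  by_contra! h
  have hnot : ∀ Z ∈ p.carrier, Z ∈ p.ray X → Z ∉ p.ray B := fun Z hZ hZX hZB => hBX <|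
    p.ray_eq X hX.left_mem Z hZ hZX ▸ (p.ray_eq B hB Z hZ hZB).symm ▸ p.mem_ray B hB
  have hXr := p.mem_ray X hX.left_mem
  exact π.not_three_points_of_cover (p.ray_mem_lines X hX.left_mem) (p.ray_mem_lines B hB) hcover
    hXr hX.mem_ray hCX (hnot X hX.left_mem hXr) (hnot X' hX.right_mem hX.mem_ray)
    (hnot C hC hCX) (p.mem_ray B hB) hBX hX.ne h.1.symm h.2.symm

/-- The extension of a trace of a pencil to a map of the plane is a dilation map. -/
theorem IsTrace.isDilationMap {f : Pt → Pt} {B B' : Pt} (hP : π.IsTrace p P P')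
    (hB : π.IsTrace p B B') (hBP : B ∉ p.ray P) (hPB : π.Para P B P' B')
    (hf : ∀ X ∈ p.carrier, π.IsTrace p X (f X)) (hfc : ∀ X ∉ p.carrier, f X = X)
    (hfP : ∀ X ∉ p.ray P, π.Para P X P' (f X)) (hfB : ∀ X ∉ p.ray B, π.Para B X B' (f X)) :
    π.IsDilationMap f := by
  have hPB' := p.notMem_ray_symm hP.left_mem hB.left_mem hBP
  have hfP' : f P = P' := p.para_unique hB.left_mem hPB' (hf P hP.left_mem).mem_ray hP.mem_ray
    (hfB P hPB') hPB.swap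
  have hfB' : f B = B' := p.para_unique hP.left_mem hBP (hf B hB.left_mem).mem_ray hB.mem_ray
    (hfP B hBP) hPB
  -- The case that neither base pair settles: X is on the ray of P and Y on the ray of B.
  have mixed : ∀ X ∈ p.carrier, ∀ Y ∈ p.carrier, X ∈ p.ray P → Y ∈ p.ray B →
      π.Para X Y (f X) (f Y) := by
    intro X hX Y hY hXP hYB
    have hXr := p.ray_eq P hP.left_mem X hX hXP
    have hYr := p.ray_eq B hB.left_mem Y hY hYB
    have hXB : X ∉ p.ray B := fun h => hBP
      (hXr ▸ (p.ray_eq B hB.left_mem X hX h).symm ▸ p.mem_ray B hB.left_mem)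
    have hYP : Y ∉ p.ray P := fun h => hPB'
      (hYr ▸ (p.ray_eq P hP.left_mem Y hY h).symm ▸ p.mem_ray P hP.left_mem)
    -- If the two rays cover the plane, there is no third ray for Desargues' axiom; then the rays
    -- carry only P, P' and B, B', and `f` swaps each pair.
    by_cases hc : ∀ Z, Z ∈ p.ray P ∨ Z ∈ p.ray B
    · by_cases h1 : X = P
      · subst h1
        rw [hfP']
        exact hfP Y hYP
      by_cases h2 : Y = B
      · subst h2
        rw [hfB']
        exact (hfB X hXB).swap
      have h3 := (hP.eq_or_eq_of_cover hB.left_mem hBP hc hX hXP).resolve_left h1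
      have h4 := (hB.eq_or_eq_of_cover hP.left_mem hPB' (fun Z => (hc Z).symm) hY
        hYB).resolve_left h2
      have tX := hf X hX
      have tY := hf Y hY
      have h5 := (hP.eq_or_eq_of_cover hB.left_mem hBP hc tX.right_mem
        (hXr ▸ tX.mem_ray)).resolve_right (h3 ▸ tX.ne.symm)
      have h6 := (hB.eq_or_eq_of_cover hP.left_mem hPB' (fun Z => (hc Z).symm) tY.right_mem
        (hYr ▸ tY.mem_ray)).resolve_right (h4 ▸ tY.ne.symm)
      rw [h5, h6, h3, h4]
      exact hPB.symm
    · push Not at hc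
      obtain ⟨C, hCP, hCB⟩ := hc
      have hC := p.mem_carrier hP.left_mem hCP
      -- C serves as a new base: B controls CX, P controls CY, and Desargues' axiom then gives XY.
      refine (hf C hC).para (hf X hX) (hf Y hY) ?_ ?_
        (hB.para (hf C hC) (hf X hX) hCB hXB (hfB C hCB) (hfB X hXB))
        (hP.para (hf C hC) (hf Y hY) hCP hYP (hfP C hCP) (hfP Y hYP))
      · exact fun h => hCP (hXr ▸ (p.ray_eq C hC X hX h).symm ▸ p.mem_ray C hC)
      · exact fun h => hCB (hYr ▸ (p.ray_eq C hC Y hY h).symm ▸ p.mem_ray C hC)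
  intro X Y
  by_cases hX : X ∈ p.carrier
  · by_cases hY : Y ∈ p.carrier
    · by_cases hXP : X ∈ p.ray P
      · by_cases hYB : Y ∈ p.ray B
        · exact mixed X hX Y hY hXP hYB
        · have hXB : X ∉ p.ray B := fun h => hBP (p.ray_eq P hP.left_mem X hX hXP ▸
            (p.ray_eq B hB.left_mem X hX h).symm ▸ p.mem_ray B hB.left_mem)
          exact hB.para (hf X hX) (hf Y hY) hXB hYB (hfB X hXB) (hfB Y hYB)
      · by_cases hYP : Y ∈ p.ray P
        · by_cases hXB : X ∈ p.ray B
          · exact (mixed Y hY X hX hYP hXB).swap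
          · have hYB : Y ∉ p.ray B := fun h => hBP (p.ray_eq P hP.left_mem Y hY hYP ▸
              (p.ray_eq B hB.left_mem Y hY h).symm ▸ p.mem_ray B hB.left_mem)
            exact hB.para (hf X hX) (hf Y hY) hXB hYB (hfB X hXB) (hfB Y hYB)
        · exact hP.para (hf X hX) (hf Y hY) hXP hYP (hfP X hXP) (hfP Y hYP)
    · rw [hfc Y hY]
      exact .of_mem_mem (p.ray_mem_lines X hX) (p.mem_ray X hX) (p.center_mem X hX Y hY)
        (hf X hX).mem_ray (p.center_mem X hX Y hY)
  · by_cases hY : Y ∈ p.carrier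
    · rw [hfc X hX]
      exact .of_mem_mem (p.ray_mem_lines Y hY) (p.center_mem Y hY X hX) (p.mem_ray Y hY)
        (p.center_mem Y hY X hX) (hf Y hY).mem_ray
    · obtain rfl := p.center_unique X hX Y hY
      exact .of_left_eq _ _ _

/-- An auxiliary pair B, B' is built from P, P'. Points off the ray of P are moved by means of P,
the others by means of B; off both rays the two constructions agree by Desargues' axiom. -/
theorem IsTrace.exists_isDilationMap (hP : π.IsTrace p P P') :
    ∃ f : Pt → Pt, π.IsDilationMap f ∧ f P = P' ∧ (∀ X ∈ p.carrier, f X ∈ p.ray X) ∧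
      ∀ X ∉ p.carrier, f X = X := by
  obtain ⟨B, hBP⟩ := π.exists_notMem (p.ray_mem_lines P hP.left_mem)
  obtain ⟨B', hB', hBB', hne, hPB⟩ :=
    p.exists_para hP.left_mem hP.right_mem hP.mem_ray hP.ne hBP
  have hBc := p.mem_carrier hP.left_mem hBP
  have hB : π.IsTrace p B B' := ⟨hBc, hB', hBB', hne⟩
  have hPB' := p.notMem_ray_symm hP.left_mem hBc hBP
  have key : ∀ X, ∃ X', (X ∈ p.carrier → π.IsTrace p X X') ∧ (X ∉ p.carrier → X' = X) ∧
      (X ∉ p.ray P → π.Para P X P' X') ∧ (X ∉ p.ray B → π.Para B X B' X') := by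
    intro X
    by_cases hX : X ∈ p.carrier
    · by_cases hXP : X ∈ p.ray P
      · have hXB : X ∉ p.ray B := fun h => hBP (p.ray_eq P hP.left_mem X hX hXP ▸
          (p.ray_eq B hBc X hX h).symm ▸ p.mem_ray B hBc)
        obtain ⟨X', h1, h2, h3, h4⟩ := p.exists_para hBc hB' hBB' hne hXB
        exact ⟨X', fun _ => ⟨hX, h1, h2, h3⟩, absurd hX, absurd hXP, fun _ => h4⟩
      · obtain ⟨X', h1, h2, h3, h4⟩ :=
          p.exists_para hP.left_mem hP.right_mem hP.mem_ray hP.ne hXP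
        have hXt : π.IsTrace p X X' := ⟨hX, h1, h2, h3⟩
        exact ⟨X', fun _ => hXt, absurd hX, fun _ => h4,
          fun _ => hP.para hB hXt hBP hXP hPB h4⟩
    · exact ⟨X, fun h => absurd h hX, fun _ => rfl,
        fun h => absurd (p.center_mem P hP.left_mem X hX) h,
        fun h => absurd (p.center_mem B hBc X hX) h⟩
  choose f hf hfc hfP hfB using key
  exact ⟨f, hP.isDilationMap hB hBP hPB hf hfc hfP hfB,
    p.para_unique hBc hPB' (hf P hP.left_mem).mem_ray hP.mem_ray (hfB P hPB') hPB.swap,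
    fun X hX => (hf X hX).mem_ray, hfc⟩

/-- A point B off the ray of P stays both on its ray and on PB, so it is a second fixed point. -/
theorem eq_id_of_mem_ray {f : Pt → Pt} (hf : π.IsDilationMap f) (hP : P ∈ p.carrier)
    (hfP : f P = P) (hfr : ∀ X ∈ p.carrier, f X ∈ p.ray X) : f = id := by
  obtain ⟨B, hB⟩ := π.exists_notMem (p.ray_mem_lines P hP)
  have hBc := p.mem_carrier hP hB
  have h := hf P B
  rw [hfP] at h
  exact hf.ext .id (p.ne_of_notMem_ray hP hB) hfP (p.para_unique hP hB (hfr B hBc)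
    (p.mem_ray B hBc) h (IsDilationMap.id P B))

/-- A pencil has a dilation that takes a given point to a given point of the same line of the
pencil. -/
theorem exists_perm (p : π.Pencil) (hP : P ∈ p.carrier) (hP' : P' ∈ p.carrier)
    (hPP' : P' ∈ p.ray P) :
    ∃ f : Equiv.Perm Pt, π.IsDilationMap f ∧ f P = P' ∧ (∀ X ∈ p.carrier, f X ∈ p.ray X) ∧
      ∀ X ∉ p.carrier, f X = X := by
  by_cases hne : P = P'
  · exact ⟨1, .id, hne, p.mem_ray, fun _ _ => rfl⟩
  have hP1 : π.IsTrace p P P' := ⟨hP, hP', hPP', hne⟩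
  have hP2 : π.IsTrace p P' P := ⟨hP', hP, hP1.ray_eq ▸ p.mem_ray P hP, Ne.symm hne⟩
  obtain ⟨f, hf, hfP, hfr, hfc⟩ := hP1.exists_isDilationMap
  obtain ⟨g, hg, hgP, hgr, hgc⟩ := hP2.exists_isDilationMap
  -- The extension of the reversed pair is the inverse: the composite fixes P and preserves rays.
  have key : ∀ {P P' : Pt} {f g : Pt → Pt}, P ∈ p.carrier → π.IsDilationMap f → f P = P' →
      (∀ X ∈ p.carrier, f X ∈ p.ray X) → (∀ X ∉ p.carrier, f X = X) → π.IsDilationMap g →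
      g P' = P → (∀ X ∈ p.carrier, g X ∈ p.ray X) → (∀ X ∉ p.carrier, g X = X) →
      g ∘ f = id := by
    intro P P' f g hP hf hfP hfr hfc hg hgP hgr hgc
    refine eq_id_of_mem_ray (hg.comp hf) hP (by simp [hfP, hgP]) fun X hX => ?_
    by_cases h : f X ∈ p.carrier
    · rw [← p.ray_eq X hX (f X) h (hfr X hX)]
      exact hgr _ h
    · rw [Function.comp_apply, hgc _ h]
      exact hfr X hX
  exact ⟨⟨f, g, congrFun (key hP hf hfP hfr hfc hg hgP hgr hgc),
    congrFun (key hP' hg hgP hgr hgc hf hfP hfr hfc)⟩, hf, hfP, hfr, hfc⟩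

end DesarguesAffinePlane

theorem perm_apply_inv_apply {α : Type*} (f : Equiv.Perm α) (x : α) : f (f⁻¹ x) = x :=
  f.apply_symm_apply x

theorem perm_inv_apply_apply {α : Type*} (f : Equiv.Perm α) (x : α) : f⁻¹ (f x) = x :=
  f.symm_apply_apply x

/-! ### Translations -/

namespace AffinePlane

variable {Pt : Type*} {π : AffinePlane Pt}

theorem IsDilationMap.inv {f : Equiv.Perm Pt} (hf : π.IsDilationMap f) :
    π.IsDilationMap ⇑f⁻¹ := fun X Y => by
  have h := hf (f⁻¹ X) (f⁻¹ Y)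
  rw [perm_apply_inv_apply, perm_apply_inv_apply] at h
  exact h.symm

variable (π) in
/-- The permutation `t` is a translation in the direction of the line `l`. -/
structure IsTranslation (l : Set Pt) (t : Equiv.Perm Pt) : Prop where
  isDilationMap : π.IsDilationMap t
  mem_par : ∀ X, t X ∈ π.par X l

namespace IsTranslation

variable {l m : Set Pt} {s t : Equiv.Perm Pt}

theorem one (hl : l ∈ π.lines) : π.IsTranslation l 1 := ⟨.id, fun X => π.mem_par X hl⟩

theorem mul (hl : l ∈ π.lines) (hs : π.IsTranslation l s) (ht : π.IsTranslation l t) :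
    π.IsTranslation l (s * t) :=
  ⟨hs.isDilationMap.comp ht.isDilationMap, fun X =>
    π.par_eq_par hl (ht.mem_par X) ▸ hs.mem_par (t X)⟩

theorem inv (hl : l ∈ π.lines) (ht : π.IsTranslation l t) : π.IsTranslation l t⁻¹ := by
  refine ⟨ht.isDilationMap.inv, fun X => ?_⟩
  have h := ht.mem_par (t⁻¹ X)
  rw [perm_apply_inv_apply] at h
  rw [π.par_eq_par hl h]
  exact π.mem_par _ hl

theorem congr (hl : l ∈ π.lines) (hm : m ∈ π.lines) (h : LinesParallel l m)
    (ht : π.IsTranslation l t) : π.IsTranslation m t :=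
  ⟨ht.isDilationMap, fun X => π.par_congr hl hm h ▸ ht.mem_par X⟩

theorem conj (hl : l ∈ π.lines) {f : Equiv.Perm Pt} (hf : π.IsDilationMap f)
    (ht : π.IsTranslation l t) : π.IsTranslation l (f * t * f⁻¹) := by
  refine ⟨(hf.comp ht.isDilationMap).comp hf.inv, fun X => ?_⟩
  have h := hf.map_mem_par hl (ht.mem_par (f⁻¹ X))
  rwa [perm_apply_inv_apply] at h

/-- A point Y off the trace of X stays both on XY and on its own trace, so it is fixed as well. -/
theorem eq_one (hl : l ∈ π.lines) (ht : π.IsTranslation l t) {X : Pt} (hX : t X = X) :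
    t = 1 := by
  obtain ⟨Y, hY⟩ := π.exists_notMem (π.par_mem_lines X hl)
  have hXY : X ≠ Y := fun h => hY (h ▸ π.mem_par X hl)
  have hXY' := π.line_mem_lines hXY
  refine DFunLike.coe_injective (ht.isDilationMap.ext .id hXY hX ?_)
  have h := (ht.isDilationMap X Y).mem_par_line hXY
  rw [hX] at h
  refine π.eq_of_mem_par hXY' hl (fun h' => hY ?_) h (ht.mem_par Y)
    (by rw [π.par_self hXY' (π.left_mem_line hXY)]; exact π.right_mem_line hXY) (π.mem_par Y hl)
  rw [π.par_eq hl hXY' (π.left_mem_line hXY) h'.symm]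
  exact π.right_mem_line hXY

theorem eq_one_of_not_linesParallel (hl : l ∈ π.lines) (hm : m ∈ π.lines)
    (h : ¬ LinesParallel l m) (ht : π.IsTranslation l t) (ht' : π.IsTranslation m t) :
    t = 1 :=
  Equiv.ext fun X => π.eq_of_mem_par hl hm h (ht.mem_par X) (ht'.mem_par X) (π.mem_par X hl)
    (π.mem_par X hm)

/-- Bracketed as s(ts⁻¹t⁻¹) the commutator is a translation along l, as (sts⁻¹)t⁻¹ one along m;
hence it is trivial. -/
theorem commute_of_not_linesParallel (hl : l ∈ π.lines) (hm : m ∈ π.lines)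
    (h : ¬ LinesParallel l m) (hs : π.IsTranslation l s) (ht : π.IsTranslation m t) :
    Commute s t := by
  have h1 : π.IsTranslation l (s * (t * s⁻¹ * t⁻¹)) :=
    hs.mul hl ((hs.inv hl).conj hl ht.isDilationMap)
  have h2 : π.IsTranslation m (s * t * s⁻¹ * t⁻¹) :=
    (ht.conj hm hs.isDilationMap).mul hm (ht.inv hm)
  have h3 : s * t * s⁻¹ * t⁻¹ = 1 :=
    eq_one_of_not_linesParallel hl hm h (by simpa only [mul_assoc] using h1) h2
  exact mul_inv_eq_iff_eq_mul.1 (mul_inv_eq_one.1 h3)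

end IsTranslation

/-- A dilation without fixed points is a translation. -/
theorem IsDilationMap.isTranslation {f : Equiv.Perm Pt} (hf : π.IsDilationMap f)
    (h : ∀ X, f X ≠ X) (X : Pt) : π.IsTranslation (π.line X (f X)) f := by
  have hl (Y : Pt) := π.line_mem_lines (h Y).symm
  have hL (Y : Pt) := π.left_mem_line (h Y).symm
  have hR (Y : Pt) := π.right_mem_line (h Y).symm
  refine ⟨hf, fun Y => ?_⟩
  -- Each line joining a point to its image is mapped into itself, so the intersection of two
  -- nonparallel ones would be fixed.
  have hp : LinesParallel (π.line X (f X)) (π.line Y (f Y)) := by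
    by_contra hn
    obtain ⟨Z, hZX, hZY⟩ := exists_mem_of_not_linesParallel hn
    have trace (W : Pt) (hW : Z ∈ π.line W (f W)) : f Z ∈ π.line W (f W) := by
      have h1 := hf.mem_par (hl W) (hL W) hW
      rwa [π.par_self (hl W) (hR W)] at h1
    exact h Z (π.points_eq (hl X) (hl Y) (fun h' => hn (Or.inl h')) (trace X hZX) (trace Y hZY)
      hZX hZY)
  rw [π.par_eq (hl X) (hl Y) (hL Y) hp]
  exact hR Y

namespace IsTranslation

variable {l m : Set Pt} {s t : Equiv.Perm Pt}

/-- For nonparallel directions, a fixed point X of st satisfies t X = s⁻¹ X, a point on both traces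
of X; so t is trivial. Without fixed points, st is a translation. -/
theorem exists_mul (hl : l ∈ π.lines) (hm : m ∈ π.lines) (hs : π.IsTranslation l s)
    (ht : π.IsTranslation m t) : ∃ n ∈ π.lines, π.IsTranslation n (s * t) := by
  by_cases h : LinesParallel l m
  · exact ⟨m, hm, (hs.congr hl hm h).mul hm ht⟩
  by_cases hf : ∃ X, (s * t) X = X
  · obtain ⟨X, hX⟩ := hf
    have h1 : t X = s⁻¹ X := Equiv.Perm.eq_inv_iff_eq.2 hX
    have h2 : t X = X := π.eq_of_mem_par hl hm h (h1 ▸ (hs.inv hl).mem_par X) (ht.mem_par X)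
      (π.mem_par X hl) (π.mem_par X hm)
    rw [ht.eq_one hm h2, mul_one]
    exact ⟨l, hl, hs⟩
  · push Not at hf
    obtain ⟨X, -⟩ := π.noncollinear
    have hd : π.IsDilationMap ⇑(s * t) := hs.isDilationMap.comp ht.isDilationMap
    exact ⟨_, π.line_mem_lines (hf X).symm, hd.isTranslation hf X⟩

/-- Translations with the same effect on one point are equal. -/
theorem eq_of_apply_eq (hl : l ∈ π.lines) (hm : m ∈ π.lines) (hs : π.IsTranslation l s)
    (ht : π.IsTranslation m t) {X : Pt} (h : s X = t X) : s = t := by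
  obtain ⟨n, hn, hst⟩ := exists_mul hm hl (ht.inv hm) hs
  exact (inv_mul_eq_one.1 (hst.eq_one hn (X := X)
    (by rw [Equiv.Perm.mul_apply, h, perm_inv_apply_apply]))).symm

end IsTranslation

end AffinePlane

/-! ### Commutativity of translations and the point reflection -/

namespace DesarguesAffinePlane

open AffinePlane

variable {Pt : Type*} (π : DesarguesAffinePlane Pt)

theorem exists_isTranslation {l : Set Pt} (hl : l ∈ π.lines) {P P' : Pt} (h : P' ∈ π.par P l) :
    ∃ t, π.IsTranslation l t ∧ t P = P' := by
  obtain ⟨t, ht, htP, htr, -⟩ :=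
    π.exists_perm (π.parallelPencil hl) (Set.mem_univ P) (Set.mem_univ P') h
  exact ⟨t, ⟨ht, fun X => htr X trivial⟩, htP⟩

/-- For parallel directions, take r in another direction. Then rt is not along l either, so s
commutes with r and with rt, hence with t. -/
theorem commute_of_isTranslation {l m : Set Pt} (hl : l ∈ π.lines) (hm : m ∈ π.lines)
    {s t : Equiv.Perm Pt} (hs : π.IsTranslation l s) (ht : π.IsTranslation m t) :
    Commute s t := by
  by_cases h : LinesParallel l m
  swap
  · exact hs.commute_of_not_linesParallel hl hm h ht
  replace ht := ht.congr hm hl h.symm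
  by_cases ht1 : t = 1
  · exact ht1 ▸ Commute.one_right s
  obtain ⟨X, -⟩ := π.noncollinear
  obtain ⟨Y, hY⟩ := π.exists_notMem (π.par_mem_lines X hl)
  have hXY : X ≠ Y := fun h => hY (h ▸ π.mem_par X hl)
  have hk := π.line_mem_lines hXY
  have hlk : ¬ LinesParallel l (π.line X Y) := fun h => hY <| by
    rw [π.par_eq hl hk (π.left_mem_line hXY) h]
    exact π.right_mem_line hXY
  obtain ⟨r, hr, hrX⟩ := π.exists_isTranslation hk (P := X) (P' := Y)
    (by rw [π.par_self hk (π.left_mem_line hXY)]; exact π.right_mem_line hXY)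
  obtain ⟨n, hn, hrt⟩ := hr.exists_mul hk hl ht
  have hln : ¬ LinesParallel l n := fun h => by
    have h1 := (hrt.congr hn hl h.symm).mul hl (ht.inv hl)
    rw [mul_inv_cancel_right] at h1
    rw [h1.eq_one_of_not_linesParallel hl hk hlk hr] at hrX
    exact hXY hrX
  have h1 := hs.commute_of_not_linesParallel hl hn hln hrt
  have h2 := (hs.commute_of_not_linesParallel hl hk hlk hr).inv_right.mul_right h1
  rwa [inv_mul_cancel_left] at h2

theorem exists_translation (P Q : Pt) : ∃ t, (∃ l ∈ π.lines, π.IsTranslation l t) ∧ t P = Q := by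
  obtain ⟨l, hl, hP, hQ⟩ := π.exists_line P Q
  obtain ⟨t, ht, h⟩ := π.exists_isTranslation hl (P := P) (P' := Q) (by rwa [π.par_self hl hP])
  exact ⟨t, ⟨l, hl, ht⟩, h⟩

/-- The translation that takes `P` to `Q`. -/
noncomputable def translation (P Q : Pt) : Equiv.Perm Pt := (π.exists_translation P Q).choose

theorem translation_apply (P Q : Pt) : π.translation P Q P = Q :=
  (π.exists_translation P Q).choose_spec.2

theorem isTranslation_translation (P Q : Pt) :
    ∃ l ∈ π.lines, π.IsTranslation l (π.translation P Q) :=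
  (π.exists_translation P Q).choose_spec.1

theorem eq_translation {l : Set Pt} (hl : l ∈ π.lines) {t : Equiv.Perm Pt}
    (ht : π.IsTranslation l t) {P Q : Pt} (h : t P = Q) : t = π.translation P Q := by
  obtain ⟨m, hm, h'⟩ := π.isTranslation_translation P Q
  exact ht.eq_of_apply_eq hl hm h' (h.trans (π.translation_apply P Q).symm)

theorem isTranslation_translation_of_mem {l : Set Pt} (hl : l ∈ π.lines) {P Q : Pt}
    (hP : P ∈ l) (hQ : Q ∈ l) : π.IsTranslation l (π.translation P Q) := by
  obtain ⟨t, ht, h⟩ := π.exists_isTranslation hl (P := P) (P' := Q) (by rwa [π.par_self hl hP])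
  exact π.eq_translation hl ht h ▸ ht

/-- The conjugate is again a translation, and a translation is determined by its value at P. -/
theorem conj_translation {f : Equiv.Perm Pt} (hf : π.IsDilationMap f) {P : Pt} (hP : f P = P)
    (Q : Pt) : f * π.translation P Q * f⁻¹ = π.translation P (f Q) := by
  obtain ⟨l, hl, h⟩ := π.isTranslation_translation P Q
  refine π.eq_translation hl (h.conj hl hf) ?_
  rw [Equiv.Perm.mul_apply, Equiv.Perm.mul_apply, Equiv.Perm.inv_eq_iff_eq.2 hP.symm,
    π.translation_apply]

/-- The reflection of the plane about the point `O`. -/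
noncomputable def pointReflection (O X : Pt) : Pt := (π.translation O X)⁻¹ O

theorem translation_pointReflection (O X : Pt) :
    π.translation O (π.pointReflection O X) = (π.translation O X)⁻¹ := by
  obtain ⟨l, hl, h⟩ := π.isTranslation_translation O X
  exact (π.eq_translation hl (h.inv hl) rfl).symm

theorem pointReflection_involutive (O : Pt) : Function.Involutive (π.pointReflection O) := by
  intro X
  rw [pointReflection, translation_pointReflection, inv_inv, translation_apply]

theorem translation_self (O : Pt) : π.translation O O = 1 := by
  obtain ⟨l, hl, -⟩ := π.exists_line O O
  exact (π.eq_translation hl (.one hl) rfl).symm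

theorem pointReflection_self (O : Pt) : π.pointReflection O O = O := by
  rw [pointReflection, translation_self]
  rfl

/-- With s, t the translations from O to X and Y, the translation st⁻¹ sends Y to X and, because s
and t commute, s⁻¹(O) to t⁻¹(O). Both joining lines therefore have its direction. -/
theorem isDilationMap_pointReflection (O : Pt) : π.IsDilationMap (π.pointReflection O) := by
  intro X Y
  obtain ⟨l, hl, hX⟩ := π.isTranslation_translation O X
  obtain ⟨m, hm, hY⟩ := π.isTranslation_translation O Y
  obtain ⟨n, hn, ht⟩ := hX.exists_mul hl hm (hY.inv hm)
  have h1 := ht.mem_par Y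
  have h2 := ht.mem_par (π.pointReflection O X)
  rw [Equiv.Perm.mul_apply, Equiv.Perm.inv_eq_iff_eq.2 (π.translation_apply O Y).symm,
    π.translation_apply] at h1
  rw [(π.commute_of_isTranslation hl hm hX hY).inv_right.eq, Equiv.Perm.mul_apply,
    pointReflection, perm_apply_inv_apply] at h2
  exact (Para.of_mem (π.par_mem_lines Y hn) h1 (π.mem_par Y hn)
    (π.par_congr hn (π.par_mem_lines Y hn) (π.linesParallel_par Y hn) ▸ h2))

/-- The dilations with centre `O` commute with the reflection about `O`. -/
theorem map_pointReflection {f : Equiv.Perm Pt} (hf : π.IsDilationMap f) {O : Pt} (hO : f O = O)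
    (X : Pt) : f (π.pointReflection O X) = π.pointReflection O (f X) := by
  rw [pointReflection, pointReflection, ← π.conj_translation hf hO]
  simp only [mul_inv_rev, inv_inv, Equiv.Perm.mul_apply]
  rw [Equiv.Perm.inv_eq_iff_eq.2 hO.symm]

end DesarguesAffinePlane

/-! ### The operations on `ℓ^{OI}` and the cross ratio -/

namespace DesarguesAffinePlane

open AffinePlane

variable {Pt : Type*} (π : DesarguesAffinePlane Pt) {O I : Pt}

theorem epsilon_eq {α : Sort*} {h : Nonempty α} {p : α → Prop} {a : α} (hp : ∀ x, p x ↔ x = a) :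
    @Classical.epsilon α h p = a :=
  (hp _).1 (Classical.epsilon_spec ⟨a, (hp a).2 rfl⟩)

/-- The translation from O to A carries B₁ to P₁, and therefore B to C. -/
theorem isSum_iff (hOI : O ≠ I) {A B C : Pt} (hA : A ∈ π.line O I) (hB : B ∈ π.line O I) :
    π.IsSum O I A B C ↔ C = π.translation O A B := by
  have hl := π.line_mem_lines hOI
  have hO := π.left_mem_line hOI
  have ht := π.isTranslation_translation_of_mem hl hO hA
  have hd := ht.isDilationMap
  have key : ∀ B₁ ∉ π.line O I, π.translation O A B₁ ∈
      π.parallelThrough B₁ O I ∩ π.parallelThrough A O B₁ ∧ π.translation O A B ∈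
      π.parallelThrough (π.translation O A B₁) B B₁ ∩ π.line O I := by
    intro B₁ hB₁
    have hOB : O ≠ B₁ := fun h => hB₁ (h ▸ hO)
    have hBB : B ≠ B₁ := fun h => hB₁ (h ▸ hB)
    refine ⟨⟨ht.mem_par B₁, ?_⟩, (hd B B₁).swap.mem_par hBB.symm (π.line_mem_lines hBB)
      (π.right_mem_line hBB) (π.left_mem_line hBB), ?_⟩
    · have h := (hd O B₁).mem_par_line hOB
      rwa [π.translation_apply] at h
    · have h := ht.mem_par B
      rwa [π.par_self hl hB] at h
  constructor
  · rintro ⟨B₁, P₁, hB₁, ⟨h1, h2⟩, h3, h4⟩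
    obtain ⟨⟨k1, k2⟩, k3, k4⟩ := key B₁ hB₁
    have hOB : O ≠ B₁ := fun h => hB₁ (h ▸ hO)
    have hBB : B ≠ B₁ := fun h => hB₁ (h ▸ hB)
    obtain rfl : P₁ = π.translation O A B₁ :=
      π.eq_of_mem_par hl (π.line_mem_lines hOB) (not_linesParallel_of_mem
        (fun h => hB₁ (h ▸ π.right_mem_line hOB)) hO (π.left_mem_line hOB)) h1 h2 k1 k2
    rw [← π.par_self hl hO] at h4 k4
    exact π.eq_of_mem_par (π.line_mem_lines hBB) hl (not_linesParallel_of_mem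
        (fun h => hB₁ (h ▸ π.right_mem_line hBB)) (π.left_mem_line hBB) hB) h3 h4 k3 k4
  · rintro rfl
    obtain ⟨B₁, hB₁⟩ := π.exists_notMem hl
    exact ⟨B₁, _, hB₁, (key B₁ hB₁).1, (key B₁ hB₁).2⟩

/-- The map `f` carries B₁ to P₁, and therefore B to C. Bijectivity is not required, so that the
constant map O covers the left factor O. -/
theorem isProd_iff (hOI : O ≠ I) {f : Pt → Pt} (hf : π.IsDilationMap f) (hfO : f O = O)
    {B C : Pt} (hB : B ∈ π.line O I) : π.IsProd O I (f I) B C ↔ C = f B := by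
  have hl := π.line_mem_lines hOI
  have hO := π.left_mem_line hOI
  have hI := π.right_mem_line hOI
  have key : ∀ B₁ ∉ π.line O I, f B₁ ∈ π.parallelThrough (f I) I B₁ ∩ π.line O B₁ ∧
      f B ∈ π.parallelThrough (f B₁) B B₁ ∩ π.line O I := by
    intro B₁ hB₁
    have hOB : O ≠ B₁ := fun h => hB₁ (h ▸ hO)
    have hIB : I ≠ B₁ := fun h => hB₁ (h ▸ hI)
    have hBB : B ≠ B₁ := fun h => hB₁ (h ▸ hB)
    refine ⟨⟨(hf I B₁).mem_par_line hIB, ?_⟩, (hf B B₁).swap.mem_par hBB.symm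
      (π.line_mem_lines hBB) (π.right_mem_line hBB) (π.left_mem_line hBB), ?_⟩
    · have h := (hf O B₁).mem_par_line hOB
      rwa [hfO, π.par_self (π.line_mem_lines hOB) (π.left_mem_line hOB)] at h
    · have h := hf.mem_par hl hO hB
      rwa [hfO, π.par_self hl hO] at h
  constructor
  · rintro ⟨B₁, P₁, hB₁, ⟨h1, h2⟩, h3, h4⟩
    obtain ⟨⟨k1, k2⟩, k3, k4⟩ := key B₁ hB₁
    have hOB : O ≠ B₁ := fun h => hB₁ (h ▸ hO)
    have hIB : I ≠ B₁ := fun h => hB₁ (h ▸ hI)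
    have hBB : B ≠ B₁ := fun h => hB₁ (h ▸ hB)
    have hOBl := π.line_mem_lines hOB
    rw [← π.par_self hOBl (π.left_mem_line hOB)] at h2 k2
    obtain rfl : P₁ = f B₁ := by
      refine π.eq_of_mem_par (π.line_mem_lines hIB) hOBl (not_linesParallel_of_mem
        (fun h => hB₁ ?_) (π.right_mem_line hIB) (π.right_mem_line hOB)) h1 h2 k1 k2
      rw [π.line_eq hOI hOBl (π.left_mem_line hOB) (h ▸ π.left_mem_line hIB)]
      exact π.right_mem_line hOB
    rw [← π.par_self hl hO] at h4 k4
    exact π.eq_of_mem_par (π.line_mem_lines hBB) hl (not_linesParallel_of_mem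
        (fun h => hB₁ (h ▸ π.right_mem_line hBB)) (π.left_mem_line hBB) hB) h3 h4 k3 k4
  · rintro rfl
    obtain ⟨B₁, hB₁⟩ := π.exists_notMem hl
    exact ⟨B₁, _, hB₁, (key B₁ hB₁).1, (key B₁ hB₁).2⟩

theorem add_eq (hOI : O ≠ I) {A B : Pt} (hA : A ∈ π.line O I) (hB : B ∈ π.line O I) :
    π.add O I A B = π.translation O A B :=
  epsilon_eq fun _ => π.isSum_iff hOI hA hB

theorem mul_eq (hOI : O ≠ I) {f : Pt → Pt} (hf : π.IsDilationMap f) (hfO : f O = O)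
    {B : Pt} (hB : B ∈ π.line O I) : π.mul O I (f I) B = f B :=
  epsilon_eq fun _ => π.isProd_iff hOI hf hfO hB

theorem pointReflection_mem (hOI : O ≠ I) {A : Pt} (hA : A ∈ π.line O I) :
    π.pointReflection O A ∈ π.line O I := by
  have hl := π.line_mem_lines hOI
  have hO := π.left_mem_line hOI
  have h := (π.isDilationMap_pointReflection O).mem_par hl hO hA
  rwa [π.pointReflection_self, π.par_self hl hO] at h

theorem neg_eq (hOI : O ≠ I) {A : Pt} (hA : A ∈ π.line O I) :
    π.neg O I A = π.pointReflection O A := by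
  refine epsilon_eq fun X => ⟨fun h => ?_, fun h => ?_⟩
  · rw [π.add_eq hOI hA h.1] at h
    exact Equiv.Perm.eq_inv_iff_eq.2 h.2
  · subst h
    have h := π.pointReflection_mem hOI hA
    exact ⟨h, by rw [π.add_eq hOI hA h, pointReflection, perm_apply_inv_apply]⟩

theorem reflection_eq (hOI : O ≠ I) {A : Pt} (hA : A ∈ π.line O I) :
    π.reflection O I A = π.pointReflection O A := by
  rw [reflection, inversion, π.neg_eq hOI (π.right_mem_line hOI)]
  exact π.mul_eq hOI (π.isDilationMap_pointReflection O) (π.pointReflection_self O) hA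

theorem add_mem (hOI : O ≠ I) {A B : Pt} (hA : A ∈ π.line O I) (hB : B ∈ π.line O I) :
    π.add O I A B ∈ π.line O I := by
  have hl := π.line_mem_lines hOI
  have h := (π.isTranslation_translation_of_mem hl (π.left_mem_line hOI) hA).mem_par B
  rwa [π.par_self hl hB, ← π.add_eq hOI hA hB] at h

theorem add_pointReflection (hOI : O ≠ I) {A B : Pt} (hA : A ∈ π.line O I)
    (hB : B ∈ π.line O I) : π.add O I (π.pointReflection O A) (π.pointReflection O B) =
      π.pointReflection O (π.add O I A B) := by
  rw [π.add_eq hOI (π.pointReflection_mem hOI hA) (π.pointReflection_mem hOI hB),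
    π.add_eq hOI hA hB]
  -- The reflection conjugates the translation from O to A into the one from O to -A.
  have h := π.conj_translation (f := (π.pointReflection_involutive O).toPerm)
    (π.isDilationMap_pointReflection O) (π.pointReflection_self O) A
  rw [mul_inv_eq_iff_eq_mul] at h
  exact (DFunLike.congr_fun h B).symm

theorem sub_mem (hOI : O ≠ I) {A B : Pt} (hA : A ∈ π.line O I) (hB : B ∈ π.line O I) :
    π.sub O I A B ∈ π.line O I := by
  rw [sub, π.neg_eq hOI hB]
  exact π.add_mem hOI hA (π.pointReflection_mem hOI hB)

theorem sub_pointReflection (hOI : O ≠ I) {A B : Pt} (hA : A ∈ π.line O I)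
    (hB : B ∈ π.line O I) : π.sub O I (π.pointReflection O A) (π.pointReflection O B) =
      π.pointReflection O (π.sub O I A B) := by
  have hB' := π.pointReflection_mem hOI hB
  rw [sub, sub, π.neg_eq hOI hB, π.neg_eq hOI hB', π.add_pointReflection hOI hA hB']

/-- If A - B = O, the translation from O to A takes -B to O, so -B = -A. The inverses in the cross
ratio therefore exist. -/
theorem sub_ne (hOI : O ≠ I) {A B : Pt} (hA : A ∈ π.line O I) (hB : B ∈ π.line O I)
    (h : A ≠ B) : O ≠ π.sub O I A B := by
  intro h'
  rw [sub, π.neg_eq hOI hB, π.add_eq hOI hA (π.pointReflection_mem hOI hB)] at h'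
  exact h ((π.pointReflection_involutive O).injective (Equiv.Perm.eq_inv_iff_eq.2 h'.symm)).symm

theorem exists_dilation (hOI : O ≠ I) {A : Pt} (hA : A ∈ π.line O I) (hOA : O ≠ A) :
    ∃ f : Equiv.Perm Pt, π.IsDilationMap f ∧ f O = O ∧ f I = A := by
  obtain ⟨f, hf, hfI, -, hfO⟩ := π.exists_perm (π.centralPencil O) hOI hOA hA
  exact ⟨f, hf, hfO O (not_not.2 rfl), hfI⟩

theorem exists_dilationMap (hOI : O ≠ I) {A : Pt} (hA : A ∈ π.line O I) :
    ∃ f : Pt → Pt, π.IsDilationMap f ∧ f O = O ∧ f I = A ∧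
      ∀ X, f (π.pointReflection O X) = π.pointReflection O (f X) := by
  by_cases hOA : O = A
  · subst hOA
    exact ⟨_, .const O, rfl, rfl,
      fun _ => (π.pointReflection_self O).symm⟩
  · obtain ⟨f, hf, hfO, hfI⟩ := π.exists_dilation hOI hA hOA
    exact ⟨f, hf, hfO, hfI, π.map_pointReflection hf hfO⟩

/-- If `f` is left multiplication by A, then its composite with the reflection is left
multiplication by -A. -/
theorem pointReflection_mul (hOI : O ≠ I) {A B : Pt} (hA : A ∈ π.line O I)
    (hB : B ∈ π.line O I) :
    π.mul O I (π.pointReflection O A) B = π.pointReflection O (π.mul O I A B) := by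
  obtain ⟨f, hf, hfO, rfl, -⟩ := π.exists_dilationMap hOI hA
  rw [π.mul_eq hOI hf hfO hB]
  exact π.mul_eq hOI ((π.isDilationMap_pointReflection O).comp hf)
    (by rw [Function.comp_apply, hfO, π.pointReflection_self]) hB

theorem mul_pointReflection (hOI : O ≠ I) {A B : Pt} (hA : A ∈ π.line O I)
    (hB : B ∈ π.line O I) :
    π.mul O I A (π.pointReflection O B) = π.pointReflection O (π.mul O I A B) := by
  obtain ⟨f, hf, hfO, rfl, h⟩ := π.exists_dilationMap hOI hA
  rw [π.mul_eq hOI hf hfO hB, π.mul_eq hOI hf hfO (π.pointReflection_mem hOI hB), h]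

theorem pointReflection_mul_pointReflection (hOI : O ≠ I) {A B : Pt} (hA : A ∈ π.line O I)
    (hB : B ∈ π.line O I) :
    π.mul O I (π.pointReflection O A) (π.pointReflection O B) = π.mul O I A B := by
  rw [π.pointReflection_mul hOI hA (π.pointReflection_mem hOI hB),
    π.mul_pointReflection hOI hA hB, π.pointReflection_involutive]

/-- The inverse is f⁻¹(I), where `f` is the dilation fixing O with f(I) = A. -/
theorem exists_inv (hOI : O ≠ I) {A : Pt} (hA : A ∈ π.line O I) (hOA : O ≠ A) :
    ∃ W ∈ π.line O I, ∀ X, X ∈ π.line O I ∧ π.mul O I A X = I ↔ X = W := by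
  obtain ⟨f, hf, hfO, rfl⟩ := π.exists_dilation hOI hA hOA
  have hl := π.line_mem_lines hOI
  have hO := π.left_mem_line hOI
  have hW := hf.inv.mem_par hl hO (π.right_mem_line hOI)
  rw [Equiv.Perm.inv_eq_iff_eq.2 hfO.symm, π.par_self hl hO] at hW
  refine ⟨f⁻¹ I, hW, fun X => ⟨fun h => ?_, fun h => ?_⟩⟩
  · rw [π.mul_eq hOI hf hfO h.1] at h
    exact Equiv.Perm.eq_inv_iff_eq.2 h.2
  · subst h
    exact ⟨hW, by rw [π.mul_eq hOI hf hfO hW, perm_apply_inv_apply]⟩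

theorem inv_mem (hOI : O ≠ I) {A : Pt} (hA : A ∈ π.line O I) (hOA : O ≠ A) :
    π.inv O I A ∈ π.line O I := by
  obtain ⟨W, hW, h⟩ := π.exists_inv hOI hA hOA
  rwa [inv, epsilon_eq h]

theorem inv_pointReflection (hOI : O ≠ I) {A : Pt} (hA : A ∈ π.line O I) (hOA : O ≠ A) :
    π.inv O I (π.pointReflection O A) = π.pointReflection O (π.inv O I A) := by
  obtain ⟨W, hW, h⟩ := π.exists_inv hOI hA hOA
  have hinv : π.inv O I A = W := epsilon_eq h
  rw [hinv]
  refine epsilon_eq fun X => ⟨fun hX => ?_, fun hX => ?_⟩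
  -- From (-A) · X = I follows A · (-X) = I, so -X = W.
  · have hX' := π.pointReflection_mem hOI hX.1
    rw [← (h (π.pointReflection O X)).1 ⟨hX', ?_⟩, π.pointReflection_involutive]
    rw [π.mul_pointReflection hOI hA hX.1, ← π.pointReflection_mul hOI hA hX.1, hX.2]
  · subst hX
    exact ⟨π.pointReflection_mem hOI hW, by
      rw [π.pointReflection_mul_pointReflection hOI hA hW, ((h W).2 rfl).2]⟩

theorem inv_sub_mul_sub_pointReflection (hOI : O ≠ I) {A B C D : Pt} (hA : A ∈ π.line O I)
    (hB : B ∈ π.line O I) (hC : C ∈ π.line O I) (hD : D ∈ π.line O I) (h : A ≠ B) :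
    π.mul O I
      (π.inv O I (π.sub O I (π.pointReflection O A) (π.pointReflection O B)))
      (π.sub O I (π.pointReflection O C) (π.pointReflection O D)) =
    π.mul O I (π.inv O I (π.sub O I A B)) (π.sub O I C D) := by
  have hAB := π.sub_mem hOI hA hB
  have hne := π.sub_ne hOI hA hB h
  rw [π.sub_pointReflection hOI hA hB, π.sub_pointReflection hOI hC hD,
    π.inv_pointReflection hOI hAB hne,
    π.pointReflection_mul_pointReflection hOI (π.inv_mem hOI hAB hne) (π.sub_mem hOI hC hD)]

theorem crossRatio_pointReflection (hOI : O ≠ I) {A B C D : Pt} (hA : A ∈ π.line O I)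
    (hB : B ∈ π.line O I) (hC : C ∈ π.line O I) (hD : D ∈ π.line O I) :
    π.crossRatio O I (π.pointReflection O A) (π.pointReflection O B) (π.pointReflection O C)
      (π.pointReflection O D) = π.crossRatio O I A B C D := by
  have hinj := (π.pointReflection_involutive O).injective
  unfold crossRatio
  -- Injectivity makes the value ∞ occur on both sides at once.
  rw [hinj.eq_iff, hinj.eq_iff]
  split_ifs with h
  · rfl
  · push Not at h
    rw [π.inv_sub_mul_sub_pointReflection hOI hA hD hB hD h.1,
      π.inv_sub_mul_sub_pointReflection hOI hB hC hA hC h.2]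

end DesarguesAffinePlane

theorem mainTheorem8 {Pt : Type*} (π : DesarguesAffinePlane Pt) (O I : Pt) (hOI : O ≠ I) :
    (∀ X ∈ π.line O I,
      π.reflection O I X ∈ π.line O I ∧ π.reflection O I X = π.neg O I X) ∧
    ∀ A ∈ π.line O I, ∀ B ∈ π.line O I, ∀ C ∈ π.line O I, ∀ D ∈ π.line O I,
      NoThreeEqual A B C D →
      NoThreeEqual (π.reflection O I A) (π.reflection O I B)
        (π.reflection O I C) (π.reflection O I D) ∧
      π.crossRatio O I (π.reflection O I A) (π.reflection O I B)
        (π.reflection O I C) (π.reflection O I D) = π.crossRatio O I A B C D := by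
  refine ⟨fun X hX => ?_, fun A hA B hB C hC D hD h => ?_⟩
  · rw [π.neg_eq hOI hX, π.reflection_eq hOI hX]
    exact ⟨π.pointReflection_mem hOI hX, rfl⟩
  · have hinj := (π.pointReflection_involutive O).injective
    rw [π.reflection_eq hOI hA, π.reflection_eq hOI hB, π.reflection_eq hOI hC,
      π.reflection_eq hOI hD]
    refine ⟨?_, π.crossRatio_pointReflection hOI hA hB hC hD⟩
    simpa only [NoThreeEqual, hinj.eq_iff] using h
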